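/- Let $X$ be a Banach analytic manifold, i.e. a connected Hausdorff topological space with an atlas of charts onto open subsets of a complex Banach space whose transition maps are holomorphic. Let $\Delta=\{\lambda\in\mathbb C:|\lambda|<1\}$, and let $\mathrm{Hol}(\Delta,X)$ be the set of holomorphic maps $\Delta\to X$ with the compact-open topology. For a sequence $(f_k)$ in $\mathrm{Hol}(\Delta,X)$ let $Z_{(f_k)}$ be the set of $\lambda\in\Delta$ for which $(f_k(\lambda))$ converges in $X$. For $S\subset\Delta$ let $S^u$ be the set of points $z\in\Delta\cap\overline S$ such that for every connected open neighbourhood $U\subset\Delta$ of $z$ and every holomorphic $f:U\to\mathbb C$ with $f|_{U\cap S}=0$ one has $f=0$ on $U$. For $\Omega\subset\Delta$, the sequence $(f_k)$ is called compactly divergent on $\Omega$ if for all compact sets $K\subset\Omega$ and $L\subset X$ there is $k_0$ such that $f_k(K)\cap L=\emptyset$ for all $k\ge k_0$. **Theorem 3.11.** The following assertions are equivalent. (i) $X$ has the 1-SVP (strong Vitali property with source $\Delta$): every sequence $(f_k)$ in $\mathrm{Hol}(\Delta,X)$ with $Z_{(f_k)}^u\neq\emptyset$ converges in $\mathrm{Hol}(\Delta,X)$.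 (ii) Every sequence in $\mathrm{Hol}(\Delta,X)$ has a subsequence that either converges in $\mathrm{Hol}(\Delta,X)$ or is compactly divergent on $\Delta\setminus S$ for some discrete subset $S$ of $\Delta$ (i.e. some $S\subset\Delta$ without accumulation points in $\Delta$). -/

import Mathlib

open Set Filter Topology
open scoped Manifold ContDiff

namespace Vitali

/-- The space `Hol(A, X)` of holomorphic (that is, complex differentiable) maps from a complex
manifold `A` modelled on `E` to a complex manifold `X` modelled on `F`. As a subtype of `C(A, X)` it
carries the compact-open topology. -/
abbrev Hol (E F A X : Type*) [NormedAddCommGroup E] [NormedSpace ℂ E]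
    [NormedAddCommGroup F] [NormedSpace ℂ F] [TopologicalSpace A] [ChartedSpace E A]
    [TopologicalSpace X] [ChartedSpace F X] :=
  {f : C(A, X) // MDifferentiable 𝓘(ℂ, E) 𝓘(ℂ, F) f}

/-- The set `S^u`: points `z` of the closure of `S` such that on every connected (open)
neighbourhood `U` of `z`, the only holomorphic function `U → ℂ` vanishing on `U ∩ S` is zero.
Holomorphic functions on `U` are represented by functions on `A` that are holomorphic on `U`. -/
def uniquenessSet (E : Type*) {A : Type*} [NormedAddCommGroup E] [NormedSpace ℂ E]
    [TopologicalSpace A] [ChartedSpace E A] (S : Set A) : Set A :=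
  {z | z ∈ closure S ∧ ∀ U : Set A, IsOpen U → IsConnected U → z ∈ U → ∀ f : A → ℂ,
    MDifferentiableOn 𝓘(ℂ, E) 𝓘(ℂ, ℂ) f U → (∀ w ∈ U ∩ S, f w = 0) → ∀ w ∈ U, f w = 0}

section Sequences

variable {E F A X : Type*} [NormedAddCommGroup E] [NormedSpace ℂ E]
  [NormedAddCommGroup F] [NormedSpace ℂ F] [TopologicalSpace A] [ChartedSpace E A]
  [TopologicalSpace X] [ChartedSpace F X]

/-- The sequence converges in `Hol(A, X)`, to some element of `Hol(A, X)`. -/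
def ConvergesInHol (f : ℕ → Hol E F A X) : Prop :=
  ∃ g : Hol E F A X, Tendsto f atTop (𝓝 g)

/-- The set `Z_{f_k}` of points at which the sequence converges in `X`. -/
def convergenceSet (f : ℕ → Hol E F A X) : Set A :=
  {a | ∃ x : X, Tendsto (fun k => (f k).1 a) atTop (𝓝 x)}

/-- The sequence is compactly divergent on `Ω ⊆ A`: for all compact `K ⊆ Ω` and compact `L ⊆ X`,
`f_k(K) ∩ L = ∅` for all large `k`. -/
def CompactlyDivergentOn (f : ℕ → Hol E F A X) (Ω : Set A) : Prop :=
  ∀ K : Set A, K ⊆ Ω → IsCompact K → ∀ L : Set X, IsCompact L →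
    ∃ k₀ : ℕ, ∀ k ≥ k₀, (f k).1 '' K ∩ L = ∅

end Sequences

/-- The strong Vitali property of `X` with respect to one fixed source manifold `A`. -/
def StrongVitaliFrom (E F A X : Type*) [NormedAddCommGroup E] [NormedSpace ℂ E]
    [NormedAddCommGroup F] [NormedSpace ℂ F] [TopologicalSpace A] [ChartedSpace E A]
    [TopologicalSpace X] [ChartedSpace F X] : Prop :=
  ∀ f : ℕ → Hol E F A X, (uniquenessSet E (convergenceSet f)).Nonempty → ConvergesInHol f

/-- The open unit disk in `ℂ`, as an open subset (hence a complex manifold modelled on `ℂ`). -/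
def unitDisk : TopologicalSpace.Opens ℂ := ⟨Metric.ball 0 1, Metric.isOpen_ball⟩

/-- The 1-SVP: the strong Vitali property with the unit disk as source. -/
def OneSVP (F X : Type*) [NormedAddCommGroup F] [NormedSpace ℂ F]
    [TopologicalSpace X] [ChartedSpace F X] : Prop :=
  StrongVitaliFrom ℂ F unitDisk X

/-- Every sequence of holomorphic maps from the unit disk to `X` has a subsequence that either
converges in `Hol` or is compactly divergent on the complement of a discrete subset of the disk.
As usual for subsets of a domain, discrete means closed in the disk and discrete in the induced
topology, i.e. without accumulation points in the disk. -/
def WeaklyTaut (F X : Type*) [NormedAddCommGroup F] [NormedSpace ℂ F]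
    [TopologicalSpace X] [ChartedSpace F X] : Prop :=
  ∀ f : ℕ → Hol ℂ F unitDisk X, ∃ φ : ℕ → ℕ, StrictMono φ ∧
    (ConvergesInHol (f ∘ φ) ∨
      ∃ S : Set unitDisk, IsClosed S ∧ IsDiscrete S ∧ CompactlyDivergentOn (f ∘ φ) Sᶜ)

end Vitali

/-! In the disk, `S^u` is the set of accumulation points of `S`, so (i) concerns sequences whose
convergence set accumulates. (i) ⇒ (ii): if no subsequence converges, every subsequence has a closed
discrete convergence set. Choose a subsequence whose set `S` cannot grow under further extraction
(`exists_strictMono_maximal_convergence`). If it is not compactly divergent off `S`, then after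
extraction `a_k → b ∉ S` and `f_k(a_k) → x`. Precomposing `f_k` with polynomial self-maps of the
disk that send more and more of the points `1/(j+2)` to `a_k` and `-1/2` to `b`, the strong Vitali
property gives `f_k(b) → x` along a subsequence (`OneSVP.exists_subseq_tendsto`), against
maximality. (ii) ⇒ (i): convergence at a point outside `S` excludes compact divergence off `S`, so
every subsequence has a convergent subsequence; the identity theorem makes all limits equal. -/

namespace Vitali

/-! ### Identity theorem and accumulation points -/

section IdentityTheorem

variable {F A X : Type*} [NormedAddCommGroup F] [NormedSpace ℂ F] [CompleteSpace F]
  [TopologicalSpace A] [ChartedSpace ℂ A] [IsManifold 𝓘(ℂ, ℂ) 1 A]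
  [TopologicalSpace X] [ChartedSpace F X] [IsManifold 𝓘(ℂ, F) 1 X]

omit [CompleteSpace F] in
/-- A holomorphic map read in charts is differentiable near the image of the base point. -/
theorem eventually_differentiableAt_chart {g : A → X} {z : A} (e : OpenPartialHomeomorph X F)
    (he : e ∈ atlas F X) (hz : g z ∈ e.source)
    (hg : ∀ᶠ w in 𝓝 z, MDifferentiableAt 𝓘(ℂ, ℂ) 𝓘(ℂ, F) g w) :
    ∀ᶠ w in 𝓝 (chartAt ℂ z z), DifferentiableAt ℂ (e ∘ g ∘ (chartAt ℂ z).symm) w := by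
  have hzs : z ∈ (chartAt ℂ z).source := mem_chart_source ℂ z
  have hcont : ContinuousAt g z := hg.self_of_nhds.continuousAt
  have hsymm : Tendsto (chartAt ℂ z).symm (𝓝 (chartAt ℂ z z)) (𝓝 z) :=
    (chartAt ℂ z).tendsto_symm hzs
  filter_upwards [hsymm.eventually hg,
    hsymm.eventually (hcont.eventually (e.open_source.mem_nhds hz)),
    (chartAt ℂ z).open_target.mem_nhds ((chartAt ℂ z).map_source hzs)] with w h1 h2 h3
  rw [← mdifferentiableAt_iff_differentiableAt]
  have h4 : MDifferentiableAt 𝓘(ℂ, ℂ) 𝓘(ℂ, ℂ) (chartAt ℂ z).symm w :=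
    mdifferentiableAt_atlas_symm (chart_mem_atlas ℂ z) h3
  have h5 : MDifferentiableAt 𝓘(ℂ, F) 𝓘(ℂ, F) e (g ((chartAt ℂ z).symm w)) :=
    mdifferentiableAt_atlas he h2
  exact h5.comp w (h1.comp w h4)

/-- Two holomorphic maps of one variable that agree at points accumulating at `z` agree near `z`. -/
theorem eventually_eq_of_frequently_eq [T2Space X] {g h : A → X} {z : A}
    (hg : ∀ᶠ w in 𝓝 z, MDifferentiableAt 𝓘(ℂ, ℂ) 𝓘(ℂ, F) g w)
    (hh : ∀ᶠ w in 𝓝 z, MDifferentiableAt 𝓘(ℂ, ℂ) 𝓘(ℂ, F) h w)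
    (hgh : ∃ᶠ w in 𝓝[≠] z, g w = h w) : ∀ᶠ w in 𝓝 z, g w = h w := by
  have hgc : ContinuousAt g z := hg.self_of_nhds.continuousAt
  have hhc : ContinuousAt h z := hh.self_of_nhds.continuousAt
  -- With equal values at `z`, a single target chart serves both maps.
  have hz : g z = h z := by
    by_contra hne
    have := (hgc.ne_iff_eventually_ne hhc).1 hne
    exact hgh ((this.filter_mono nhdsWithin_le_nhds).mono fun w hw => hw)
  set φ := chartAt ℂ z with hφ
  set ψ := chartAt F (g z) with hψ
  have hzs : z ∈ φ.source := mem_chart_source ℂ z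
  have hgz : g z ∈ ψ.source := mem_chart_source F (g z)
  have hG := eventually_differentiableAt_chart ψ (chart_mem_atlas F _) hgz hg
  have hH := eventually_differentiableAt_chart ψ (chart_mem_atlas F _) (hz ▸ hgz) hh
  have hGa := Complex.analyticAt_iff_eventually_differentiableAt.2 hG
  have hHa := Complex.analyticAt_iff_eventually_differentiableAt.2 hH
  have hfreq : ∃ᶠ w in 𝓝[≠] (φ z), (ψ ∘ g ∘ φ.symm) w = (ψ ∘ h ∘ φ.symm) w := by
    have ht : Tendsto φ (𝓝[≠] z) (𝓝[≠] (φ z)) := by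
      refine tendsto_nhdsWithin_iff.2
        ⟨(φ.continuousAt hzs).tendsto.mono_left nhdsWithin_le_nhds, ?_⟩
      filter_upwards [self_mem_nhdsWithin,
        nhdsWithin_le_nhds (φ.open_source.mem_nhds hzs)] with w hw hws heq
      exact hw (φ.injOn hws hzs heq)
    refine ht.frequently ?_
    refine (hgh.and_eventually (nhdsWithin_le_nhds (φ.open_source.mem_nhds hzs))).mono ?_
    rintro w ⟨hw, hws⟩
    simp [φ.left_inv hws, hw]
  have hev := (hGa.frequently_eq_iff_eventually_eq hHa).1 hfreq
  filter_upwards [(φ.continuousAt hzs).eventually hev, φ.open_source.mem_nhds hzs,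
    hgc.eventually (ψ.open_source.mem_nhds hgz),
    hhc.eventually (ψ.open_source.mem_nhds (hz ▸ hgz))] with w h1 h2 h3 h4
  simp only [Function.comp_apply] at h1
  rw [φ.left_inv h2] at h1
  exact ψ.injOn h3 h4 h1

/-- The identity theorem for holomorphic maps of one variable. -/
theorem eqOn_of_frequently_eq [T2Space X] {g h : A → X} {U : Set A} {z : A} (hU : IsOpen U)
    (hUc : IsPreconnected U) (hz : z ∈ U) (hg : MDifferentiableOn 𝓘(ℂ, ℂ) 𝓘(ℂ, F) g U)
    (hh : MDifferentiableOn 𝓘(ℂ, ℂ) 𝓘(ℂ, F) h U) (hgh : ∃ᶠ w in 𝓝[≠] z, g w = h w) :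
    EqOn g h U := by
  have hev : ∀ {k : A → X}, MDifferentiableOn 𝓘(ℂ, ℂ) 𝓘(ℂ, F) k U → ∀ w ∈ U,
      ∀ᶠ v in 𝓝 w, MDifferentiableAt 𝓘(ℂ, ℂ) 𝓘(ℂ, F) k v := fun hk w hw => by
    filter_upwards [hU.mem_nhds hw] with v hv using hk.mdifferentiableAt (hU.mem_nhds hv)
  set V : Set A := {w | ∀ᶠ v in 𝓝 w, g v = h v} with hV
  have hVo : IsOpen V := isOpen_setOfPred_eventually_nhds
  have hsub : U ⊆ V := by
    refine hUc.subset_of_closure_inter_subset hVo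
      ⟨z, hz, eventually_eq_of_frequently_eq (hev hg z hz) (hev hh z hz) hgh⟩ ?_
    rintro w ⟨hwV, hwU⟩
    by_contra hw
    refine hw (eventually_eq_of_frequently_eq (hev hg w hwU) (hev hh w hwU) ?_)
    have h1 : ∃ᶠ v in 𝓝 w, v ∈ V := mem_closure_iff_frequently.1 hwV
    rw [frequently_nhdsWithin_iff]
    refine h1.mono fun v hv => ⟨hv.self_of_nhds, ?_⟩
    rintro rfl
    exact hw hv
  exact fun w hw => (hsub hw).self_of_nhds

omit [CompleteSpace F] [IsManifold 𝓘(ℂ, F) 1 X] in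
/-- An accumulation point of `S` is a point of `S^u`. -/
theorem mem_uniquenessSet_of_accPt {S : Set A} {z : A} (hz : AccPt z (𝓟 S)) :
    z ∈ uniquenessSet ℂ S := by
  refine ⟨mem_closure_iff_clusterPt.2 hz.clusterPt, fun U hU hUc hzU f hf hfS => ?_⟩
  refine eqOn_of_frequently_eq (h := fun _ => 0) hU hUc.isPreconnected hzU hf
    (fun w _ => mdifferentiableWithinAt_const) ?_
  rw [accPt_iff_frequently_nhdsNE] at hz
  refine (hz.and_eventually (nhdsWithin_le_nhds (hU.mem_nhds hzU))).mono ?_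
  rintro w ⟨hwS, hwU⟩
  exact hfS w ⟨hwU, hwS⟩

end IdentityTheorem

/-- In the unit disk, the points of `S^u` are accumulation points of `S`. -/
theorem accPt_of_mem_uniquenessSet {S : Set unitDisk} {z : unitDisk}
    (hz : z ∈ uniquenessSet ℂ S) : AccPt z (𝓟 S) := by
  by_contra hacc
  rw [accPt_iff_frequently_nhdsNE, not_frequently, eventually_nhdsWithin_iff,
    Metric.eventually_nhds_iff_ball] at hacc
  obtain ⟨r, hr, hrS⟩ := hacc
  have hconn : IsConnected (Metric.ball z r) := by
    have hc : IsConnected (Metric.ball (z : ℂ) r ∩ Metric.ball (0 : ℂ) 1) :=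
      ((convex_ball _ _).inter (convex_ball _ _)).isConnected ⟨z, Metric.mem_ball_self hr, z.2⟩
    refine ⟨⟨z, Metric.mem_ball_self hr⟩, ?_⟩
    rw [← IsInducing.subtypeVal.isPreconnected_image]
    convert hc.isPreconnected using 1
    ext w
    constructor
    · rintro ⟨v, hv, rfl⟩
      exact ⟨hv, v.2⟩
    · rintro ⟨h1, h2⟩
      exact ⟨⟨w, h2⟩, h1, rfl⟩
  have hval : MDifferentiable 𝓘(ℂ, ℂ) 𝓘(ℂ, ℂ) (Subtype.val : unitDisk → ℂ) :=
    (contMDiff_subtype_val (n := 1)).mdifferentiable one_ne_zero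
  -- The ball meets `S` at most in `z`, so `w - z` vanishes there without being zero.
  have hzero := hz.2 _ Metric.isOpen_ball hconn (Metric.mem_ball_self hr)
    (fun w : unitDisk => (w : ℂ) - z)
    ((hval.sub mdifferentiable_const).mdifferentiableOn) (by
      rintro w ⟨hw, hwS⟩
      by_contra hne
      exact hrS w hw (fun h => hne (by rw [h, sub_self])) hwS)
  have hzb : Tendsto (fun n : ℕ => (z : ℂ) + (1 / ((n : ℝ) + 1) : ℝ)) atTop (𝓝 z) := by
    have := (Complex.continuous_ofReal.tendsto 0).comp
      (tendsto_one_div_add_atTop_nhds_zero_nat (𝕜 := ℝ))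
    simpa using this.const_add (z : ℂ)
  obtain ⟨n, hn1, hn2⟩ := ((hzb.eventually (Metric.ball_mem_nhds (z : ℂ) hr)).and
    (hzb.eventually (unitDisk.isOpen.mem_nhds z.2))).exists
  have := hzero ⟨_, hn2⟩ hn1
  simp only [add_sub_cancel_left] at this
  rw [Complex.ofReal_eq_zero] at this
  exact (by positivity : (1 / ((n : ℝ) + 1)) ≠ 0) this

/-! ### Subsequences with maximal convergence set -/

/-- Every sequence of maps has a subsequence whose set of convergence points does not grow under
passage to further subsequences, provided that convergence sets of subsequences are finite on each
piece of a countable exhaustion. -/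
theorem exists_strictMono_maximal_convergence {D X : Type*} [TopologicalSpace X] (f : ℕ → D → X)
    (i : D → ℕ)
    (hfin : ∀ φ : ℕ → ℕ, StrictMono φ → ∀ N,
      {a | i a ≤ N ∧ ∃ x, Tendsto (fun k => f (φ k) a) atTop (𝓝 x)}.Finite) :
    ∃ φ : ℕ → ℕ, StrictMono φ ∧ ∀ ψ : ℕ → ℕ, StrictMono ψ → ∀ a x,
      Tendsto (fun k => f (φ (ψ k)) a) atTop (𝓝 x) →
        ∃ y, Tendsto (fun k => f (φ k) a) atTop (𝓝 y) := by
  -- These filters stand in for subsequences; a decreasing sequence of them has its infimum in `C`,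
  -- which replaces the diagonal argument.
  let C : Type := {l : Filter ℕ // l ≤ atTop ∧ l.NeBot ∧ l.IsCountablyGenerated}
  let Z : Filter ℕ → Set D := fun l => {a | ∃ x, Tendsto (fun k => f k a) l (𝓝 x)}
  have hZanti : ∀ {l l' : Filter ℕ}, l ≤ l' → Z l' ⊆ Z l := fun h a ⟨x, hx⟩ => ⟨x, hx.mono_left h⟩
  have hsub : ∀ l : C, ∃ φ : ℕ → ℕ, StrictMono φ ∧ Tendsto φ atTop l.1 := by
    rintro ⟨l, hl, hne, hcg⟩
    obtain ⟨u, hu⟩ := exists_seq_tendsto l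
    obtain ⟨ψ, hψ, huψ⟩ := strictMono_subseq_of_tendsto_atTop (hu.mono_right hl)
    exact ⟨u ∘ ψ, huψ, hu.comp hψ.tendsto_atTop⟩
  by_cases hmax : ∃ l : C, ∀ l' : C, l'.1 ≤ l.1 → Z l'.1 ⊆ Z l.1
  · obtain ⟨l, hl⟩ := hmax
    obtain ⟨φ, hφ, hφl⟩ := hsub l
    refine ⟨φ, hφ, fun ψ hψ a x hx => ?_⟩
    let l' : C := ⟨map (φ ∘ ψ) atTop, (hφ.comp hψ).tendsto_atTop, inferInstance, inferInstance⟩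
    have hl' : l'.1 ≤ l.1 := hφl.comp hψ.tendsto_atTop
    obtain ⟨y, hy⟩ := hl l' hl' ⟨x, tendsto_map'_iff.2 hx⟩
    exact ⟨y, hy.comp hφl⟩
  exfalso
  push Not at hmax
  -- Greedy choice: among all points that can still be gained, gain one of least index `i`.
  have hstep : ∀ l : C, ∃ l' : C, l'.1 ≤ l.1 ∧ ∃ a, a ∈ Z l'.1 ∧ a ∉ Z l.1 ∧
      ∀ l'' : C, l''.1 ≤ l.1 → ∀ p ∈ Z l''.1, p ∉ Z l.1 → i a ≤ i p := by
    intro l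
    let T : Set D := {a | ∃ l' : C, l'.1 ≤ l.1 ∧ a ∈ Z l'.1 ∧ a ∉ Z l.1}
    have hT : T.Nonempty := by
      obtain ⟨l', hl', h⟩ := hmax l
      obtain ⟨a, ha, ha'⟩ := not_subset.1 h
      exact ⟨a, l', hl', ha, ha'⟩
    obtain ⟨l', hl', ha, ha'⟩ := Function.argminOn_mem i T hT
    exact ⟨l', hl', _, ha, ha', fun l'' h p hp hp' =>
      Function.argminOn_le i T ⟨l'', h, hp, hp'⟩⟩
  choose nxt hnxt pt hpt hpt' hmin using hstep
  let l₀ : C := ⟨atTop, le_rfl, inferInstance, inferInstance⟩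
  let s : ℕ → C := fun n => nxt^[n] l₀
  have hs : ∀ n, s (n + 1) = nxt (s n) := fun n => Function.iterate_succ_apply' nxt n l₀
  have hanti : Antitone fun n => (s n).1 := antitone_nat_of_succ_le fun n => by
    rw [hs]
    exact hnxt _
  let linf : C := ⟨⨅ n, (s n).1, (iInf_le _ 0).trans (s 0).2.1,
    by
      have : ∀ n, (s n).1.NeBot := fun n => (s n).2.2.1
      exact iInf_neBot_of_directed' hanti.directed_ge this,
    by
      have : ∀ n, (s n).1.IsCountablyGenerated := fun n => (s n).2.2.2
      infer_instance⟩
  have hinf : ∀ n, linf.1 ≤ (s n).1 := fun n => iInf_le _ n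
  have hptZ : ∀ n, pt (s n) ∈ Z (s (n + 1)).1 := fun n => by rw [hs]; exact hpt _
  have hinj : Function.Injective fun n => pt (s n) := by
    have hlt : ∀ m n, m < n → pt (s m) ≠ pt (s n) := fun m n hmn heq =>
      hpt' (s n) (heq ▸ hZanti (hanti (Nat.succ_le_of_lt hmn)) (hptZ m))
    intro m n heq
    by_contra hne
    rcases lt_or_gt_of_ne hne with h | h
    exacts [hlt m n h heq, hlt n m h heq.symm]
  obtain ⟨l', hl', h⟩ := hmax linf
  obtain ⟨p, hp, hp'⟩ := not_subset.1 h
  -- A point `p` gained beyond `linf` was a candidate at every stage, so the infinitely many chosen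
  -- points all have index at most `i p`, contradicting `hfin`.
  have hle : ∀ n, i (pt (s n)) ≤ i p := fun n =>
    hmin (s n) l' (hl'.trans (hinf n)) p hp fun hpn => hp' (hZanti (hinf n) hpn)
  obtain ⟨φ, hφ, hφl⟩ := hsub linf
  refine infinite_of_injective_forall_mem hinj (fun n => ?_) (hfin φ hφ (i p))
  obtain ⟨x, hx⟩ := hZanti (hinf (n + 1)) (hptZ n)
  exact ⟨hle n, x, hx.comp hφl⟩

/-! ### Polynomial self-maps of the disk -/

/-- Precomposition with a holomorphic self-map of the disk, given as an entire function. -/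
noncomputable def Hol.reparam {F X : Type*} [NormedAddCommGroup F] [NormedSpace ℂ F] [TopologicalSpace X]
    [ChartedSpace F X] (f : Hol ℂ F unitDisk X) (q : ℂ → ℂ) (hq : Differentiable ℂ q)
    (hmaps : ∀ w : unitDisk, q w ∈ unitDisk) : Hol ℂ F unitDisk X :=
  ⟨f.1.comp ⟨fun w => ⟨q w, hmaps w⟩, (hq.continuous.comp continuous_subtype_val).subtype_mk _⟩, by
    have h1 : ContMDiff 𝓘(ℂ, ℂ) 𝓘(ℂ, ℂ) ∞ (fun w : unitDisk => (⟨q w, hmaps w⟩ : unitDisk)) := by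
      rw [← ContMDiff.subtypeVal_comp_iff]
      exact (hq.contDiff.contMDiff).comp contMDiff_subtype_val
    exact f.2.comp (h1.mdifferentiable (by simp))⟩

/-- The monic polynomial with simple zeros `1/2, 1/3, …, 1/(m+1)`. -/
noncomputable def nodal (m : ℕ) (w : ℂ) : ℂ := ∏ j ∈ Finset.range m, (w - 1 / ((j : ℂ) + 2))

theorem differentiable_nodal (m : ℕ) : Differentiable ℂ (nodal m) := by
  unfold nodal
  fun_prop

theorem nodal_eq_zero {m j : ℕ} (h : j < m) : nodal m (1 / ((j : ℂ) + 2)) = 0 :=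
  Finset.prod_eq_zero (Finset.mem_range.2 h) (sub_self _)

theorem norm_one_div_add_two_lt (j : ℕ) : ‖(1 / ((j : ℂ) + 2))‖ < 1 := by
  have : ((j : ℂ) + 2) = (((j : ℝ) + 2 : ℝ) : ℂ) := by push_cast; rfl
  rw [this, norm_div, norm_one, Complex.norm_real, Real.norm_of_nonneg (by positivity),
    div_lt_one (by positivity)]
  linarith [(Nat.cast_nonneg j : (0 : ℝ) ≤ j)]

theorem norm_nodal_le (m : ℕ) {w : ℂ} (hw : ‖w‖ < 1) : ‖nodal m w‖ ≤ 2 ^ m := by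
  rw [nodal, norm_prod]
  calc ∏ j ∈ Finset.range m, ‖w - 1 / ((j : ℂ) + 2)‖ ≤ ∏ _j ∈ Finset.range m, (2 : ℝ) :=
        Finset.prod_le_prod (fun _ _ => norm_nonneg _) fun j _ => by
          linarith [norm_sub_le w (1 / ((j : ℂ) + 2)), norm_one_div_add_two_lt j]
    _ = 2 ^ m := by simp

theorem le_norm_nodal_neg_half (m : ℕ) : (1 / 2) ^ m ≤ ‖nodal m (-1 / 2)‖ := by
  rw [nodal, norm_prod]
  calc ((1 / 2 : ℝ)) ^ m = ∏ _j ∈ Finset.range m, (1 / 2 : ℝ) := by simp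
    _ ≤ _ := Finset.prod_le_prod (fun _ _ => by norm_num) fun j _ => by
      have h : (-1 / 2 - 1 / ((j : ℂ) + 2)) = ((-(1 / 2 + 1 / ((j : ℝ) + 2)) : ℝ) : ℂ) := by
        push_cast; ring
      have h2 : (0 : ℝ) ≤ 1 / ((j : ℝ) + 2) := by positivity
      rw [h, Complex.norm_real, norm_neg, Real.norm_of_nonneg (by positivity)]
      linarith

/-- Each factor is at most `2` on the disk and at least `1/2` in norm at `-1/2`. The bound dictates
how close `a_k` must be to `b` for the polynomial to map the disk into itself. -/
theorem norm_nodal_div_le (m : ℕ) {w : ℂ} (hw : ‖w‖ < 1) :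
    ‖nodal m w / nodal m (-1 / 2)‖ ≤ 4 ^ m := by
  have h1 := norm_nodal_le m hw
  have h2 := le_norm_nodal_neg_half m
  have h3 : (0 : ℝ) < (1 / 2) ^ m := by positivity
  rw [norm_div, div_le_iff₀ (h3.trans_le h2)]
  calc ‖nodal m w‖ ≤ 2 ^ m := h1
    _ = 4 ^ m * (1 / 2) ^ m := by rw [← mul_pow]; norm_num
    _ ≤ _ := by gcongr

theorem nodal_neg_half_ne_zero (m : ℕ) : nodal m (-1 / 2) ≠ 0 :=
  norm_pos_iff.1 ((by positivity : (0 : ℝ) < (1 / 2) ^ m).trans_le (le_norm_nodal_neg_half m))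

/-- A set containing all the points `1/(j+2)` accumulates at `0`. -/
theorem accPt_zero {S : Set unitDisk}
    (hS : ∀ j : ℕ, ∀ h : 1 / ((j : ℂ) + 2) ∈ unitDisk, (⟨_, h⟩ : unitDisk) ∈ S) :
    AccPt (⟨0, Metric.mem_ball_self one_pos⟩ : unitDisk) (𝓟 S) := by
  have hmem : ∀ j : ℕ, 1 / ((j : ℂ) + 2) ∈ unitDisk := fun j =>
    mem_ball_zero_iff.2 (norm_one_div_add_two_lt j)
  rw [accPt_iff_frequently]
  have ht : Tendsto (fun j : ℕ => (⟨_, hmem j⟩ : unitDisk)) atTop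
      (𝓝 ⟨0, Metric.mem_ball_self one_pos⟩) := by
    rw [tendsto_subtype_rng]
    have := (tendsto_one_div_add_atTop_nhds_zero_nat (𝕜 := ℂ)).comp (tendsto_add_atTop_nat 1)
    refine this.congr fun j => ?_
    simp only [Function.comp_apply]
    push_cast
    ring
  refine ht.frequently (Frequently.of_forall fun j => ⟨fun h => ?_, hS j (hmem j)⟩)
  have h2 : ((j : ℂ) + 2) ≠ 0 := by exact_mod_cast (Nat.succ_ne_zero (j + 1))
  exact one_div_ne_zero h2 (congrArg Subtype.val h)

/-- Used to extract convergent sequences from compact subsets of `X`. -/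
theorem firstCountableTopology_of_chartedSpace (F X : Type*) [TopologicalSpace F]
    [FirstCountableTopology F] [TopologicalSpace X] [ChartedSpace F X] :
    FirstCountableTopology X :=
  ⟨fun x => by
    rw [← (chartAt F x).symm_map_nhds_eq (mem_chart_source F x)]
    infer_instance⟩

/-! ### The two implications -/

section Main

variable {F X : Type*} [NormedAddCommGroup F] [NormedSpace ℂ F] [TopologicalSpace X]
  [ChartedSpace F X]

theorem tendsto_apply {f : ℕ → Hol ℂ F unitDisk X} {g : Hol ℂ F unitDisk X}
    (h : Tendsto f atTop (𝓝 g)) (a : unitDisk) :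
    Tendsto (fun k => (f k).1 a) atTop (𝓝 (g.1 a)) :=
  ((ContinuousEvalConst.continuous_eval_const a).tendsto _).comp
    ((continuous_subtype_val.tendsto _).comp h)

theorem OneSVP.convergesInHol (hX : OneSVP F X) {f : ℕ → Hol ℂ F unitDisk X} {z : unitDisk}
    (hz : AccPt z (𝓟 (convergenceSet f))) : ConvergesInHol f :=
  hX f ⟨z, mem_uniquenessSet_of_accPt hz⟩

/-- Under the strong Vitali property, convergence of `f_k` along points tending to `b` forces a
subsequence to converge at `b`. -/
theorem OneSVP.exists_subseq_tendsto [T2Space X] (hX : OneSVP F X) {f : ℕ → Hol ℂ F unitDisk X}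
    {a : ℕ → unitDisk} {b : unitDisk} {x : X} (ha : Tendsto a atTop (𝓝 b))
    (hx : Tendsto (fun k => (f k).1 (a k)) atTop (𝓝 x)) :
    ∃ φ : ℕ → ℕ, StrictMono φ ∧ Tendsto (fun k => (f (φ k)).1 b) atTop (𝓝 x) := by
  have hac : Tendsto (fun k => (a k : ℂ)) atTop (𝓝 (b : ℂ)) :=
    (continuous_subtype_val.tendsto b).comp ha
  have hb : ‖(b : ℂ)‖ < 1 := mem_ball_zero_iff.1 b.2
  have hev : ∀ m : ℕ, ∀ᶠ k in atTop, ‖(a k : ℂ)‖ + ‖(b : ℂ) - a k‖ * 4 ^ m < 1 := by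
    intro m
    have : Tendsto (fun k => ‖(a k : ℂ)‖ + ‖(b : ℂ) - a k‖ * 4 ^ m) atTop
        (𝓝 (‖(b : ℂ)‖ + ‖(b : ℂ) - b‖ * 4 ^ m)) :=
      hac.norm.add ((hac.const_sub _).norm.mul_const _)
    rw [sub_self, norm_zero, zero_mul, add_zero] at this
    exact this.eventually_lt_const hb
  obtain ⟨φ, hφ, hφm⟩ := extraction_forall_of_eventually hev
  refine ⟨φ, hφ, ?_⟩
  -- Each index `m = n / 2` occurs twice: for even `n` the map sends `-1/2` to `b`, for odd `n` it
  -- is constant equal to `a (φ m)`. The odd terms identify the limit at `-1/2` as `x`.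
  let t : ℕ → ℂ := fun n => if Even n then 1 else 0
  let q : ℕ → ℂ → ℂ := fun n w =>
    a (φ (n / 2)) + t n * ((b - a (φ (n / 2))) * (nodal (n / 2) w / nodal (n / 2) (-1 / 2)))
  have hq : ∀ n, Differentiable ℂ (q n) := fun n =>
    (((differentiable_nodal _).div_const _).const_mul _ |>.const_mul _).const_add _
  have hmaps : ∀ n, ∀ w : unitDisk, q n w ∈ unitDisk := by
    intro n w
    refine mem_ball_zero_iff.2 ((norm_add_le _ _).trans_lt (lt_of_le_of_lt ?_ (hφm (n / 2))))
    have ht : ‖t n‖ ≤ 1 := by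
      simp only [t]; split_ifs <;> simp
    have := norm_nodal_div_le (n / 2) (mem_ball_zero_iff.1 w.2)
    rw [norm_mul, norm_mul]
    refine add_le_add_right ?_ _
    calc _ ≤ 1 * (‖(b : ℂ) - a (φ (n / 2))‖ * 4 ^ (n / 2)) := by gcongr
      _ = _ := one_mul _
  let u : ℕ → Hol ℂ F unitDisk X := fun n => Hol.reparam (f (φ (n / 2))) (q n) (hq n) (hmaps n)
  have hu : ∀ n (w c : unitDisk), q n w = c → (u n).1 w = (f (φ (n / 2))).1 c := by
    intro n w c h
    change (f (φ (n / 2))).1 ⟨q n w, _⟩ = _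
    congr 1
    exact Subtype.ext h
  have hhalf : Tendsto (fun n : ℕ => n / 2) atTop atTop :=
    Nat.tendsto_div_const_atTop two_ne_zero
  have hxφ := hx.comp hφ.tendsto_atTop
  -- Once `n / 2 > j`, the point `1/(j+2)` is a node, hence is sent to `a (φ (n / 2))`.
  obtain ⟨g, hg⟩ := hX.convergesInHol (f := u) (accPt_zero fun j hj => ⟨x, by
    refine (hxφ.comp hhalf).congr' ?_
    filter_upwards [hhalf.eventually_gt_atTop j] with n hn
    refine (hu n _ _ ?_).symm
    simp [q, nodal_eq_zero hn, -one_div]⟩)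
  have hc : (-1 / 2 : ℂ) ∈ unitDisk := mem_ball_zero_iff.2 (by norm_num)
  have hgc := tendsto_apply hg ⟨_, hc⟩
  have heven : Tendsto (fun m : ℕ => 2 * m) atTop atTop :=
    tendsto_id.const_mul_atTop' two_pos
  have hodd : Tendsto (fun m : ℕ => 2 * m + 1) atTop atTop := tendsto_add_atTop_nat 1 |>.comp heven
  have h1 : ∀ m, (u (2 * m)).1 ⟨_, hc⟩ = (f (φ m)).1 b := by
    intro m
    have hm : 2 * m / 2 = m := by omega
    rw [hu (2 * m) _ b, hm]
    simp only [q, t, hm, even_two_mul, if_true, div_self (nodal_neg_half_ne_zero m)]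
    ring
  have h2 : ∀ m, (u (2 * m + 1)).1 ⟨_, hc⟩ = (f (φ m)).1 (a (φ m)) := by
    intro m
    have hm : (2 * m + 1) / 2 = m := by omega
    rw [hu (2 * m + 1) _ (a (φ m)), hm]
    simp [q, t, hm]
  have hgx : g.1 ⟨_, hc⟩ = x :=
    tendsto_nhds_unique ((hgc.comp hodd).congr h2) hxφ
  exact hgx ▸ (hgc.comp heven).congr h1

theorem OneSVP.weaklyTaut [T2Space X] (hX : OneSVP F X) : WeaklyTaut F X := by
  intro f
  by_cases hconv : ∃ φ : ℕ → ℕ, StrictMono φ ∧ ConvergesInHol (f ∘ φ)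
  · obtain ⟨φ, hφ, h⟩ := hconv
    exact ⟨φ, hφ, Or.inl h⟩
  push Not at hconv
  have hnacc : ∀ φ : ℕ → ℕ, StrictMono φ → ∀ z, ¬ AccPt z (𝓟 (convergenceSet (f ∘ φ))) :=
    fun φ hφ z hz => hconv φ hφ (hX.convergesInHol hz)
  have : LocallyCompactSpace unitDisk := unitDisk.isOpen.locallyCompactSpace
  let K : CompactExhaustion unitDisk := default
  -- Finiteness holds because an infinite part of a compact piece would accumulate.
  obtain ⟨φ, hφ, hmax⟩ := exists_strictMono_maximal_convergence (fun k a => (f k).1 a) K.find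
    (by
      intro φ hφ N
      by_contra hinf
      obtain ⟨z, -, hz⟩ := Set.Infinite.exists_accPt_of_subset_isCompact hinf (K.isCompact N)
        (fun a ha => K.subset ha.1 (K.mem_find a))
      exact hnacc φ hφ z (hz.mono (principal_mono.2 fun a ha => ha.2)))
  have hS : IsClosed (convergenceSet (f ∘ φ)) ∧ IsDiscrete (convergenceSet (f ∘ φ)) :=
    isClosed_and_discrete_iff.2 fun z => disjoint_iff.2 (not_neBot.1 (hnacc φ hφ z))
  refine ⟨φ, hφ, Or.inr ⟨_, hS.1, hS.2, fun C hCS hC L hL => ?_⟩⟩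
  by_contra hdiv
  push Not at hdiv
  obtain ⟨ψ, hψ, hψC⟩ := Nat.exists_strictMono_subsequence (P := fun k =>
    (((f ∘ φ) k).1 '' C ∩ L).Nonempty) fun N => by
      obtain ⟨k, hk, h⟩ := hdiv (N + 1)
      exact ⟨k, hk, h⟩
  have : ∀ k, ∃ a ∈ C, ((f ∘ φ) (ψ k)).1 a ∈ L := fun k => by
    obtain ⟨_, ⟨a, ha, rfl⟩, hL⟩ := hψC k
    exact ⟨a, ha, hL⟩
  choose a haC haL using this
  have := firstCountableTopology_of_chartedSpace F X
  obtain ⟨b, hbC, θ, hθ, hab⟩ := hC.isSeqCompact haC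
  obtain ⟨x, -, η, hη, hx⟩ := hL.isSeqCompact (fun k => haL (θ k))
  obtain ⟨χ, hχ, hb⟩ := hX.exists_subseq_tendsto
    (f := fun k => f (φ (ψ (θ (η k))))) (hab.comp hη.tendsto_atTop) hx
  exact hCS hbC (hmax (ψ ∘ θ ∘ η ∘ χ) (hψ.comp (hθ.comp (hη.comp hχ))) b x hb)

theorem WeaklyTaut.oneSVP [CompleteSpace F] [T2Space X] [IsManifold 𝓘(ℂ, F) 1 X]
    (hX : WeaklyTaut F X) : OneSVP F X := by
  rintro f ⟨z, hz⟩
  have hacc := accPt_of_mem_uniquenessSet hz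
  have hsub : ∀ ns : ℕ → ℕ, Tendsto ns atTop atTop →
      ∃ φ : ℕ → ℕ, StrictMono φ ∧ ConvergesInHol (fun k => f (ns (φ k))) := by
    intro ns hns
    obtain ⟨φ, hφ, h | ⟨S, hS, hSd, hdiv⟩⟩ := hX (f ∘ ns)
    · exact ⟨φ, hφ, h⟩
    exfalso
    obtain ⟨p, hpS, x, hx⟩ : ∃ p, p ∉ S ∧ p ∈ convergenceSet f := by
      by_contra! hcon
      have hSacc : AccPt z (𝓟 S) :=
        hacc.mono (principal_mono.2 fun p hp => by_contra fun hpS => hcon p hpS hp)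
      exact hSacc.ne (disjoint_iff.1 (isClosed_and_discrete_iff.1 ⟨hS, hSd⟩ z))
    have hxs := hx.comp (hns.comp hφ.tendsto_atTop)
    -- Test divergence on `{p}` and the compact set formed by the values at `p` and their limit.
    obtain ⟨k, hk⟩ := hdiv {p} (singleton_subset_iff.2 hpS) isCompact_singleton _
      hxs.isCompact_insert_range
    have := hk k le_rfl
    refine (this.subset : _ ⊆ (∅ : Set X)) ⟨mem_image_of_mem _ rfl, Or.inr ⟨k, rfl⟩⟩
  obtain ⟨φ, hφ, g, hg⟩ := hsub id tendsto_id
  refine ⟨g, tendsto_of_subseq_tendsto fun ns hns => ?_⟩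
  obtain ⟨ψ, hψ, h, hh⟩ := hsub ns hns
  refine ⟨ψ, ?_⟩
  have hconn : IsPreconnected (univ : Set unitDisk) := by
    rw [← IsInducing.subtypeVal.isPreconnected_image, image_univ, Subtype.range_coe]
    exact (convex_ball (0 : ℂ) 1).isPreconnected
  -- Both limits agree on the convergence set of `f`, which accumulates at `z`.
  have heq : EqOn g.1 h.1 univ := by
    refine eqOn_of_frequently_eq isOpen_univ hconn (mem_univ z) g.2.mdifferentiableOn
      h.2.mdifferentiableOn ?_
    rw [accPt_iff_frequently_nhdsNE] at hacc
    refine hacc.mono ?_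
    rintro w ⟨x, hx⟩
    rw [tendsto_nhds_unique (tendsto_apply hg w) (hx.comp hφ.tendsto_atTop),
      tendsto_nhds_unique (tendsto_apply hh w) (hx.comp (hns.comp hψ.tendsto_atTop))]
  have : g = h := Subtype.ext (ContinuousMap.ext fun w => heq (mem_univ w))
  rwa [this]

end Main

end Vitali

/-- `X` is a connected Hausdorff Banach analytic manifold modelled on the complex Banach space `E`.
Over `ℂ`, transition maps of class `C^1` are the same as holomorphic transition maps. -/
theorem theorem3p11 {E : Type*} [NormedAddCommGroup E] [NormedSpace ℂ E] [CompleteSpace E]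
    {X : Type*} [TopologicalSpace X] [T2Space X] [ConnectedSpace X] [ChartedSpace E X]
    [IsManifold 𝓘(ℂ, E) 1 X] :
    Vitali.OneSVP E X ↔ Vitali.WeaklyTaut E X :=
  ⟨Vitali.OneSVP.weaklyTaut, Vitali.WeaklyTaut.oneSVP⟩
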